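/- Let $G$ be a finite-dimensional real Lie group with a bi-invariant Riemannian metric, $H<G$ a closed subgroup, $\mathfrak g=T_1G$, $\mathfrak h=T_1H\subset\mathfrak g$, and let $\mathfrak h^\perp$ be the orthogonal complement of $\mathfrak h$ for the induced scalar product on $\mathfrak g$. Let $X=G/H$ carry its standard smooth structure, for which $\pi:G\to X$ is a smooth submersion. For $g\in G$ let $\mathrm{Ad}(g):\mathfrak g\to\mathfrak g$ denote the derivative at $1$ of $x\mapsto gxg^{-1}$. The coisotropy form $\omega^\perp$ is the $\mathfrak g$-valued $1$-form on $X$ given by $\omega^\perp(g\,\pi_*\xi)=\mathrm{Ad}(g)\,\mathrm{pr}_{\mathfrak h^\perp}(\xi)$ for $g\in G$, $\xi\in\mathfrak g$, where $g\,\pi_*\xi\in T_{gH}X$ is the derivative of $\gamma\mapsto g\gamma H$ at $\gamma=1$ in the direction $\xi$. For $x=gH\in X$ put $\mathfrak h_x=\mathrm{Ad}(g)\mathfrak h$. Let $M$ be a smooth manifold and $\varphi:M\to X$ a smooth map. For a $\mathfrak g$-valued $1$-form $a$ on $M$, let $a^\perp$ be its coisotropic component, obtained at each $m\in M$ by projecting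 the values of $a$ orthogonally onto $\mathfrak h_{\varphi(m)}^\perp$, and set $$D_\varphi a=a^\perp+\varphi^*\omega^\perp .$$ The form $a$ is the gauge potential of the connection $A=\mathrm{Ad}(g^{-1})\,\pi_1^*a+g^{-1}dg$ on the trivial bundle $\pi_1:M\times G\to M$, i.e. $\pi_1^*a=\mathrm{Ad}(g)(A-g^{-1}dg)$. For a smooth map $w:M\to G$ let $a^w$ be the gauge potential of $f_w^*A$, where $f_w(m,g)=(m,w(m)g)$; explicitly $a^w=\mathrm{Ad}(w^{-1})a+w^{-1}dw$. If $w$ stabilizes $\varphi$, that is, $w(m)\varphi(m)=\varphi(m)$ for all $m\in M$, then for every $\mathfrak g$-valued $1$-form $a$ on $M$ $$(a^w)^\perp+\varphi^*\omega^\perp=\mathrm{Ad}(w^{-1})\bigl(a^\perp+\varphi^*\omega^\perp\bigr),$$ that is, $D_\varphi(a^w)=\mathrm{Ad}(w^{-1})\,D_\varphi a$. -/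

import Mathlib

open scoped Manifold ContDiff Topology
open Manifold

noncomputable section

namespace CosetGauge

/-! ## Lie groups: adjoint action, Maurer-Cartan form, bi-invariant metrics -/

section LieGroup

variable {E : Type*} [NormedAddCommGroup E] [NormedSpace ℝ E]
  {G : Type*} [TopologicalSpace G] [ChartedSpace E G] [Group G]

/-- The adjoint action `Ad_*(g) ξ = g ξ g⁻¹` on the Lie algebra `T₁G`: the derivative at `1` of
`x ↦ g x g⁻¹`. -/
def Ad (g : G) : GroupLieAlgebra 𝓘(ℝ, E) G →L[ℝ] GroupLieAlgebra 𝓘(ℝ, E) G :=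
  mfderiv 𝓘(ℝ, E) 𝓘(ℝ, E) (fun x : G => g * x * g⁻¹) 1

lemma Ad_one : (Ad (1:G) : GroupLieAlgebra 𝓘(ℝ, E) G →L[ℝ] _) = ContinuousLinearMap.id ℝ _ := by
  unfold Ad
  have : (fun x : G => 1 * x * 1⁻¹) = id := by funext x; simp
  rw [this]; exact mfderiv_id

/-- The left-invariant Maurer-Cartan form `g⁻¹dg`: it sends `Z ∈ T_gG` to `(L_{g⁻¹})_* Z ∈ T₁G`. -/
def maurerCartan (g : G) : TangentSpace 𝓘(ℝ, E) g →L[ℝ] GroupLieAlgebra 𝓘(ℝ, E) G :=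
  mfderiv 𝓘(ℝ, E) 𝓘(ℝ, E) (fun x : G => g⁻¹ * x) g

/-- The Lie algebra `𝔥 = T₁H` of a subgroup `H` of `G`, as a subspace of `𝔤 = T₁G`: the span of
the velocities at time `0` of the curves in `H` that are smooth in `G` and start at `1`.  (These
velocities already form a subspace: multiply and reparametrise the curves.) -/
def subgroupLieAlgebra (H : Subgroup G) : Submodule ℝ (GroupLieAlgebra 𝓘(ℝ, E) G) :=
  Submodule.span ℝ {ξ | ∃ γ : ℝ → G, γ 0 = 1 ∧ ContMDiffAt 𝓘(ℝ, ℝ) 𝓘(ℝ, E) ∞ γ 0 ∧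
    (∀ᶠ t in 𝓝 (0 : ℝ), γ t ∈ H) ∧ mfderiv 𝓘(ℝ, ℝ) 𝓘(ℝ, E) γ 0 (1 : ℝ) = ξ}

variable [LieGroup 𝓘(ℝ, E) ∞ G]

lemma mdiff_conj (g x : G) :
    MDifferentiableAt 𝓘(ℝ, E) 𝓘(ℝ, E) (fun x : G => g * x * g⁻¹) x := by
  have h : ContMDiff 𝓘(ℝ, E) 𝓘(ℝ, E) ∞ (fun x : G => g * x * g⁻¹) :=
    (contMDiff_const.mul contMDiff_id).mul contMDiff_const
  exact (h x).mdifferentiableAt (by simp)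

lemma Ad_mul (g h : G) :
    (Ad (g * h) : GroupLieAlgebra 𝓘(ℝ, E) G →L[ℝ] _) = (Ad g).comp (Ad h) := by
  unfold Ad
  have : (fun x : G => g * h * x * (g * h)⁻¹) =
    (fun x : G => g * x * g⁻¹) ∘ (fun x : G => h * x * h⁻¹) := by funext x; simp [mul_assoc]
  rw [this, mfderiv_comp (I' := 𝓘(ℝ, E)) _ (mdiff_conj g _) (mdiff_conj h _)]
  have h1 : h * 1 * h⁻¹ = 1 := by simp
  rw! [h1]
  rfl

variable (E G) in
/-- A smooth Riemannian metric on the Lie group `G`. -/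
abbrev Metric : Type _ :=
  Bundle.ContMDiffRiemannianMetric 𝓘(ℝ, E) ∞ E (fun g : G => TangentSpace 𝓘(ℝ, E) g)

/-- The metric is bi-invariant: all left and all right translations are isometries. -/
structure IsBiInvariant (B : Metric E G) : Prop where
  left : ∀ (g x : G) (u v : TangentSpace 𝓘(ℝ, E) x),
    B.inner (g * x) (mfderiv 𝓘(ℝ, E) 𝓘(ℝ, E) (fun y : G => g * y) x u)
      (mfderiv 𝓘(ℝ, E) 𝓘(ℝ, E) (fun y : G => g * y) x v) = B.inner x u v
  right : ∀ (g x : G) (u v : TangentSpace 𝓘(ℝ, E) x),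
    B.inner (x * g) (mfderiv 𝓘(ℝ, E) 𝓘(ℝ, E) (fun y : G => y * g) x u)
      (mfderiv 𝓘(ℝ, E) 𝓘(ℝ, E) (fun y : G => y * g) x v) = B.inner x u v

/-- The scalar product that a metric on `G` induces on `𝔤 = T₁G`. -/
def lieInner (B : Metric E G) : LinearMap.BilinForm ℝ (GroupLieAlgebra 𝓘(ℝ, E) G) :=
  LinearMap.mk₂ ℝ (fun ξ η => B.inner 1 ξ η)
    (fun _ _ _ => by simp) (fun _ _ _ => by simp) (fun _ _ _ => by simp) (fun _ _ _ => by simp)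

instance instFiniteDimensionalTangentSpace [FiniteDimensional ℝ E] (x : G) :
    FiniteDimensional ℝ (TangentSpace 𝓘(ℝ, E) x) :=
  inferInstanceAs (FiniteDimensional ℝ E)

instance instT2SpaceTangentSpace (x : G) : T2Space (TangentSpace 𝓘(ℝ, E) x) :=
  inferInstanceAs (T2Space E)

lemma isCompl_orthogonal [FiniteDimensional ℝ E] (B : Metric E G)
    (V : Submodule ℝ (GroupLieAlgebra 𝓘(ℝ, E) G)) :
    IsCompl ((lieInner B).orthogonal V) V := by
  have hr : (lieInner B).IsRefl := fun x y h => (B.symm 1 y x).trans h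
  refine ((LinearMap.BilinForm.isCompl_orthogonal_iff_disjoint hr).2 ?_).symm
  refine Submodule.disjoint_def.2 fun x hx hx' => ?_
  by_contra hne
  exact (B.pos 1 x hne).ne' (hx' x hx)

/-- The orthogonal projection `𝔤 → 𝔤` onto the orthogonal complement `V^⊥` of a subspace `V`. -/
def perpProj [FiniteDimensional ℝ E] (B : Metric E G)
    (V : Submodule ℝ (GroupLieAlgebra 𝓘(ℝ, E) G)) :
    GroupLieAlgebra 𝓘(ℝ, E) G →L[ℝ] GroupLieAlgebra 𝓘(ℝ, E) G :=
  LinearMap.toContinuousLinearMap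
    (((lieInner B).orthogonal V).projection V (isCompl_orthogonal B V))

end LieGroup

/-! ## Gauge potentials on the trivial bundle `M × G` -/

section TrivialBundle

variable {E : Type*} [NormedAddCommGroup E] [NormedSpace ℝ E]
  {G : Type*} [TopologicalSpace G] [ChartedSpace E G] [Group G]
  {F : Type*} [NormedAddCommGroup F] [NormedSpace ℝ F]
  {M : Type*} [TopologicalSpace M] [ChartedSpace F M]

variable (E G F M) in
/-- `𝔤`-valued `1`-forms on `M`. -/
abbrev LieForm : Type _ :=
  (m : M) → (TangentSpace 𝓘(ℝ, F) m →L[ℝ] GroupLieAlgebra 𝓘(ℝ, E) G)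

variable (E G F M) in
/-- `𝔤`-valued `1`-forms on the total space `M × G`. -/
abbrev TotalForm : Type _ :=
  (p : M × G) →
    (TangentSpace (𝓘(ℝ, F).prod 𝓘(ℝ, E)) p →L[ℝ] GroupLieAlgebra 𝓘(ℝ, E) G)

/-- `a` is the gauge potential of the form `A` on `M × G`: `π₁^* a = Ad_*(g)(A - g⁻¹dg)`. -/
def IsGaugePotential (A : TotalForm E G F M) (a : LieForm E G F M) : Prop :=
  ∀ p : M × G,
    (a p.1).comp (mfderiv (𝓘(ℝ, F).prod 𝓘(ℝ, E)) 𝓘(ℝ, F) Prod.fst p) =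
      (Ad p.2).comp (A p -
        (maurerCartan p.2).comp (mfderiv (𝓘(ℝ, F).prod 𝓘(ℝ, E)) 𝓘(ℝ, E) Prod.snd p))

/-- The connection form on `M × G` with gauge potential `a`: `A = Ad_*(g⁻¹) π₁^* a + g⁻¹dg`. -/
def connectionOfPotential (a : LieForm E G F M) : TotalForm E G F M := fun p =>
  (Ad p.2⁻¹).comp ((a p.1).comp (mfderiv (𝓘(ℝ, F).prod 𝓘(ℝ, E)) 𝓘(ℝ, F) Prod.fst p)) +
    (maurerCartan p.2).comp (mfderiv (𝓘(ℝ, F).prod 𝓘(ℝ, E)) 𝓘(ℝ, E) Prod.snd p)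

/-- The gauge potential of a connection form `A` on `M × G`: restricting the defining relation
`π₁^* a = Ad_*(g)(A - g⁻¹dg)` to the section `s(m) = (m, 1)` gives `a = s^* A`. -/
def potentialOfConnection (A : TotalForm E G F M) : LieForm E G F M := fun m =>
  (A (m, 1)).comp
    (mfderiv 𝓘(ℝ, F) (𝓘(ℝ, F).prod 𝓘(ℝ, E)) (fun m' : M => (m', (1 : G))) m)

/-- `a` is the gauge potential of `connectionOfPotential a`. -/
lemma isGaugePotential_connectionOfPotential [LieGroup 𝓘(ℝ, E) ∞ G] (a : LieForm E G F M) :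
    IsGaugePotential (connectionOfPotential a) a := by
  intro p
  unfold connectionOfPotential
  rw [add_sub_cancel_right, ← ContinuousLinearMap.comp_assoc, ← Ad_mul, mul_inv_cancel, Ad_one,
    ContinuousLinearMap.id_comp]

/-- A form on `M × G` has at most one gauge potential, namely `potentialOfConnection A`. -/
lemma IsGaugePotential.eq_potentialOfConnection {A : TotalForm E G F M}
    {a : LieForm E G F M}     (h : IsGaugePotential A a) : a = potentialOfConnection A := by
  funext m
  ext v
  have := congrArg (fun L => L (mfderiv 𝓘(ℝ, F) (𝓘(ℝ, F).prod 𝓘(ℝ, E))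
    (fun m' : M => (m', (1 : G))) m v)) (h (m, 1))
  simp only [Ad_one, mfderiv_prod_left, mfderiv_fst, mfderiv_snd] at this
  unfold potentialOfConnection
  rw [mfderiv_prod_left]
  have h1 := this
  rw [ContinuousLinearMap.id_comp] at h1
  refine h1.trans ?_
  have h2 : (maurerCartan (1:G) : TangentSpace 𝓘(ℝ, E) (1:G) →L[ℝ] _) 0 = 0 := map_zero _
  change A (m,1) (v,0) - maurerCartan (1:G) (0 : TangentSpace 𝓘(ℝ, E) (1:G)) = A (m,1) (v,0)
  rw [h2, sub_zero]

/-- The gauge transformation `f_w(m, g) = (m, w(m) g)` of `M × G`. -/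
def gaugeMap (w : M → G) (p : M × G) : M × G := (p.1, w p.1 * p.2)

/-- The pullback `f_w^* A` of a form on `M × G` by the gauge transformation `f_w`. -/
def gaugePullback (w : M → G) (A : TotalForm E G F M) : TotalForm E G F M := fun p =>
  (A (gaugeMap w p)).comp
    (mfderiv (𝓘(ℝ, F).prod 𝓘(ℝ, E)) (𝓘(ℝ, F).prod 𝓘(ℝ, E)) (gaugeMap w) p)

/-- The gauge action on potentials: `a^w` is the gauge potential of `f_w^* A`, where `A` is the
connection on `M × G` with gauge potential `a`. -/
def gaugeAction (w : M → G) (a : LieForm E G F M) : LieForm E G F M :=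
  potentialOfConnection (gaugePullback w (connectionOfPotential a))

end TrivialBundle

/-! ## The coset space `X = G/H`, isotropy decomposition and coisotropy form -/

section Coset

variable {E : Type*} [NormedAddCommGroup E] [NormedSpace ℝ E] [FiniteDimensional ℝ E]
  {G : Type*} [TopologicalSpace G] [ChartedSpace E G] [Group G] [LieGroup 𝓘(ℝ, E) ∞ G]
  {H : Subgroup G}

/-- The isotropy subalgebra `𝔥_x = Ad_*(g) 𝔥 = {ξ | Ad_*(g⁻¹) ξ ∈ 𝔥}` of the point `x = gH`. -/
def isotropyAlgebra (x : G ⧸ H) : Submodule ℝ (GroupLieAlgebra 𝓘(ℝ, E) G) :=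
  (subgroupLieAlgebra H).comap
    (Ad (Quotient.out x)⁻¹ : GroupLieAlgebra 𝓘(ℝ, E) G →L[ℝ] GroupLieAlgebra 𝓘(ℝ, E) G).toLinearMap

variable {E' : Type*} [NormedAddCommGroup E'] [NormedSpace ℝ E'] [ChartedSpace E' (G ⧸ H)]

/-- The map `𝔤 → T_xX`, `ξ ↦ g (π_* ξ)`, for the representative `g` of `x = gH` picked by
`Quotient.out`: the derivative at `1` of `γ ↦ g γ H`. -/
def liftMap (x : G ⧸ H) : GroupLieAlgebra 𝓘(ℝ, E) G →L[ℝ] TangentSpace 𝓘(ℝ, E') x :=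
  mfderiv 𝓘(ℝ, E) 𝓘(ℝ, E') (fun γ : G => ((Quotient.out x * γ : G) : G ⧸ H)) 1

/-- The coisotropy form `ω^⊥` of `X = G/H`: `ω^⊥(g (π_* ξ)) = Ad_*(g) pr_{𝔥^⊥} ξ`.  To evaluate it
on `S ∈ T_xX`, `x = gH`, a linear choice of vectors `ξ` with `g (π_* ξ) = S` is used; the value does
not depend on it, since `g (π_* ξ)` determines `ξ` modulo `𝔥`. -/
def coisotropyForm (B : Metric E G) (x : G ⧸ H) :
    TangentSpace 𝓘(ℝ, E') x →L[ℝ] GroupLieAlgebra 𝓘(ℝ, E) G :=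
  (Ad (Quotient.out x)).comp ((perpProj B (subgroupLieAlgebra H)).comp
    (Classical.epsilon
      fun s : TangentSpace 𝓘(ℝ, E') x →L[ℝ] GroupLieAlgebra 𝓘(ℝ, E) G =>
        ∀ S, liftMap x (s S) = S))

variable {F : Type*} [NormedAddCommGroup F] [NormedSpace ℝ F]
  {M : Type*} [TopologicalSpace M] [ChartedSpace F M]

/-- The coisotropic component `a^⊥ = pr_{𝔥_φ^⊥} a` of a `𝔤`-valued form `a` on `M`. -/
def coisotropicPart (B : Metric E G) (φ : M → G ⧸ H) (a : LieForm E G F M) : LieForm E G F M :=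
  fun m => (perpProj B (isotropyAlgebra (φ m))).comp (a m)

variable (E') in
/-- The pullback `φ^* ω^⊥` of the coisotropy form. -/
def pullbackCoisotropy (B : Metric E G) (φ : M → G ⧸ H) : LieForm E G F M := fun m =>
  (coisotropyForm B (φ m)).comp (mfderiv 𝓘(ℝ, F) 𝓘(ℝ, E') φ m)

variable (E') in
/-- The quantity `D_φ a = a^⊥ + φ^* ω^⊥`. -/
def D (B : Metric E G) (φ : M → G ⧸ H) (a : LieForm E G F M) : LieForm E G F M :=
  coisotropicPart B φ a + pullbackCoisotropy E' B φ

end Coset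

end CosetGauge

end

/-! Near a point `m`, lift `φ` to a smooth map `s` into `G` with `sH = φ`. Since `w` stabilizes `φ`,
the map `k = s⁻¹ws` takes values in `H`. Put `τ = w⁻¹dw`, `ζ = s⁻¹ds`, `κ = k⁻¹dk`; differentiating
`ws = sk` gives `Ad(s⁻¹)τ + ζ = Ad(k⁻¹)ζ + κ` (`logDeriv_mul`). Projecting to `𝔥^⊥` kills `κ`, and
`Ad(k⁻¹)` commutes with this projection because `k` lies in `H` and the metric is bi-invariant
(`IsBiInvariant.perpProj_Ad`).

Now `φ^*ω^⊥ = Ad(s) pr ζ` and `w⁻¹s = sk⁻¹`, so the projected identity reads `τ^⊥ = Ad(w⁻¹)φ^*ω^⊥ -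
φ^*ω^⊥`. This is exactly the defect of `φ^*ω^⊥`, while `(Ad(w⁻¹)a)^⊥ = Ad(w⁻¹)a^⊥`; adding up gives
the claim.

The submersion property of `G → G/H` is used twice: local sections give `s`, and curves in fibres
show that the kernel of `liftMap` lies in `𝔥`, so that `ω^⊥` is independent of the choices in its
definition. -/

noncomputable section

namespace CosetGauge

/-! ### Submersions: local sections and curves in fibres. -/

section Manifolds

universe u

variable {E : Type u} [NormedAddCommGroup E] [NormedSpace ℝ E]
  {N : Type*} [TopologicalSpace N] [ChartedSpace E N]
  {E' : Type*} [NormedAddCommGroup E'] [NormedSpace ℝ E']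
  {X : Type*} [TopologicalSpace X] [ChartedSpace E' X]
  {F : Type*} [NormedAddCommGroup F] [NormedSpace ℝ F]
  {M : Type*} [TopologicalSpace M] [ChartedSpace F M]

/-- The linear map `ℝ → E` sending `1` to `ξ`. -/
def lineMap (ξ : E) : ℝ →L[ℝ] E := ContinuousLinearMap.toSpanSingleton ℝ ξ

/-- The chain rule, with the base point of the outer map given up to an equation. -/
lemma hasMFDerivAt_comp_of_eq {f : M → N} {g : N → X} {m : M} {y : N} (hy : f m = y)
    {g' : TangentSpace 𝓘(ℝ, E) y →L[ℝ] TangentSpace 𝓘(ℝ, E') (g y)}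
    {f' : TangentSpace 𝓘(ℝ, F) m →L[ℝ] TangentSpace 𝓘(ℝ, E) (f m)}
    (hg : HasMFDerivAt 𝓘(ℝ, E) 𝓘(ℝ, E') g y g') (hf : HasMFDerivAt 𝓘(ℝ, F) 𝓘(ℝ, E) f m f') :
    HasMFDerivAt 𝓘(ℝ, F) 𝓘(ℝ, E') (fun m' => g (f m')) m
      (ContinuousLinearMap.comp (M₂ := E) g' f') := by
  subst hy
  exact hg.comp m hf

/-- In a chart `e`, the curve `t ↦ e⁻¹ (e x + t de(ξ))` is smooth, with velocity `ξ` at `0`. -/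
lemma chart_line [IsManifold 𝓘(ℝ, E) ∞ N] {e : OpenPartialHomeomorph N E}
    (he : e ∈ IsManifold.maximalAtlas 𝓘(ℝ, E) ∞ N) {x : N} (hx : x ∈ e.source)
    (ξ : TangentSpace 𝓘(ℝ, E) x) (ξ' : E) (hξ : mfderiv 𝓘(ℝ, E) 𝓘(ℝ, E) e x ξ = ξ') :
    ContMDiffAt 𝓘(ℝ, ℝ) 𝓘(ℝ, E) ∞ (fun t : ℝ => e.symm (e x + t • ξ')) 0 ∧
    HasMFDerivAt 𝓘(ℝ, ℝ) 𝓘(ℝ, E) (fun t : ℝ => e.symm (e x + t • ξ')) 0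
      (lineMap (E := E) ξ) := by
  have hsymm : ContMDiffAt 𝓘(ℝ, E) 𝓘(ℝ, E) ∞ e.symm (e x) :=
    contMDiffAt_symm_of_mem_maximalAtlas he (e.map_source hx)
  have he' := contMDiffAt_of_mem_maximalAtlas he hx
  have hline : HasFDerivAt (fun t : ℝ => e x + t • ξ')
      (ContinuousLinearMap.toSpanSingleton ℝ ξ') (0 : ℝ) := by
    have := ((ContinuousLinearMap.toSpanSingleton ℝ ξ').hasFDerivAt (x := (0 : ℝ))).const_add (e x)
    simpa using this
  have hlin : ContDiff ℝ ∞ (fun t : ℝ => e x + t • ξ') := by fun_prop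
  have h0 : e x + (0 : ℝ) • ξ' = e x := by simp
  constructor
  · exact ContMDiffAt.comp_of_eq (g := e.symm) (f := fun t : ℝ => e x + t • ξ') hsymm
      hlin.contMDiff.contMDiffAt h0
  · have h1 := hasMFDerivAt_comp_of_eq (f := fun t : ℝ => e x + t • ξ') h0
      (hsymm.mdifferentiableAt (by simp)).hasMFDerivAt
      hline.hasMFDerivAt
    -- Differentiating `e.symm ∘ e = id` near `x` shows that the derivative of `e.symm` sends `ξ'`
    -- back to `ξ`.
    have h2 := (hsymm.mdifferentiableAt (by simp)).hasMFDerivAt.comp x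
      (he'.mdifferentiableAt (by simp)).hasMFDerivAt
    have h3 : HasMFDerivAt 𝓘(ℝ, E) 𝓘(ℝ, E) (e.symm ∘ e) x
        (ContinuousLinearMap.id ℝ E : TangentSpace 𝓘(ℝ, E) x →L[ℝ] TangentSpace 𝓘(ℝ, E) x) := by
      refine (hasMFDerivAt_id x).congr_of_eventuallyEq ?_
      filter_upwards [e.open_source.mem_nhds hx] with y hy using e.left_inv hy
    have h4 := congrArg (fun L : E →L[ℝ] E => L ξ) (hasMFDerivAt_unique h2 h3)
    refine h1.congr_mfderiv ?_
    refine ContinuousLinearMap.ext_ring ?_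
    rw [← hξ]
    exact (congrArg (mfderiv 𝓘(ℝ, E) 𝓘(ℝ, E) e.symm (e x))
      (one_smul ℝ (mfderiv 𝓘(ℝ, E) 𝓘(ℝ, E) e x ξ : E))).trans (h4.trans (one_smul ℝ (ξ : E)).symm)

/-- Every tangent vector is the velocity of a smooth curve. -/
lemma exists_curve [IsManifold 𝓘(ℝ, E) ∞ N] (x : N) (ξ : TangentSpace 𝓘(ℝ, E) x) :
    ∃ γ : ℝ → N, γ 0 = x ∧ ContMDiffAt 𝓘(ℝ, ℝ) 𝓘(ℝ, E) ∞ γ 0 ∧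
      HasMFDerivAt 𝓘(ℝ, ℝ) 𝓘(ℝ, E) γ 0 (lineMap (E := E) ξ) := by
  obtain ⟨ξ', hξ'⟩ : ∃ ξ' : E, mfderiv 𝓘(ℝ, E) 𝓘(ℝ, E) (chartAt E x) x ξ = ξ' := ⟨_, rfl⟩
  have h := chart_line (IsManifold.chart_mem_maximalAtlas (I := 𝓘(ℝ, E)) (n := ∞) x)
    (mem_chart_source E x) ξ ξ' hξ'
  exact ⟨_, by simp, h.1, h.2⟩

/-- The local normal form of a submersion. -/
lemma submersion_normal_form {f : N → X} {x : N}
    (h : IsSubmersionAt 𝓘(ℝ, E) 𝓘(ℝ, E') ∞ f x) :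
    ∃ (K : Type u) (_ : NormedAddCommGroup K) (_ : NormedSpace ℝ K) (L : E ≃L[ℝ] E' × K)
      (e : OpenPartialHomeomorph N E) (e' : OpenPartialHomeomorph X E'),
      e ∈ IsManifold.maximalAtlas 𝓘(ℝ, E) ∞ N ∧ e' ∈ IsManifold.maximalAtlas 𝓘(ℝ, E') ∞ X ∧
      x ∈ e.source ∧ Set.MapsTo f e.source e'.source ∧
      ∀ y ∈ e.source, e' (f y) = (L (e y)).1 := by
  refine ⟨h.complement, inferInstance, inferInstance, h.equiv, h.domChart, h.codChart,
    h.domChart_mem_maximalAtlas, h.codChart_mem_maximalAtlas, h.mem_domChart_source,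
    h.source_subset_preimage_source, fun y hy => ?_⟩
  have hy' : h.domChart y ∈ (h.domChart.extend 𝓘(ℝ, E)).target := by
    simpa [OpenPartialHomeomorph.extend] using h.domChart.map_source hy
  have := h.writtenInCharts hy'
  simpa [h.domChart.left_inv hy] using this

/-- A submersion has smooth local sections. -/
lemma submersion_exists_section [IsManifold 𝓘(ℝ, E) ∞ N] [IsManifold 𝓘(ℝ, E') ∞ X]
    {f : N → X} {x : N} (h : IsSubmersionAt 𝓘(ℝ, E) 𝓘(ℝ, E') ∞ f x) :
    ∃ s : X → N, s (f x) = x ∧ ContMDiffAt 𝓘(ℝ, E') 𝓘(ℝ, E) ∞ s (f x) ∧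
      ∀ᶠ y in 𝓝 (f x), f (s y) = y := by
  obtain ⟨K, _, _, L, e, e', he, he', hx, hmaps, hf⟩ := submersion_normal_form h
  have hfx := hmaps hx
  -- In the charts `f` is the first projection; the section freezes the complementary coordinate at
  -- its value at `x`.
  have hbase : L.symm (e' (f x), (L (e x)).2) = e x := by rw [hf x hx]; simp
  have hlin : ContDiff ℝ ∞ (fun u : E' => L.symm (u, (L (e x)).2)) := by fun_prop
  have hc : ContinuousAt (fun y : X => L.symm (e' y, (L (e x)).2)) (f x) :=
    hlin.continuous.continuousAt.comp (e'.continuousAt hfx)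
  refine ⟨fun y => e.symm (L.symm (e' y, (L (e x)).2)), by simp only [hbase, e.left_inv hx], ?_, ?_⟩
  · refine ContMDiffAt.comp_of_eq (g := e.symm) (f := fun y : X => L.symm (e' y, (L (e x)).2))
      (contMDiffAt_symm_of_mem_maximalAtlas he (e.map_source hx)) ?_ hbase
    exact (hlin.contMDiff.contMDiffAt).comp (f x) (contMDiffAt_of_mem_maximalAtlas he' hfx)
  · have hnhds : e.target ∈ 𝓝 (L.symm (e' (f x), (L (e x)).2)) := by
      rw [hbase]; exact e.open_target.mem_nhds (e.map_source hx)
    filter_upwards [hc.preimage_mem_nhds hnhds, e'.open_source.mem_nhds hfx] with y hy hy'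
    have hs := e.map_target hy
    refine e'.injOn (hmaps hs) hy' ?_
    rw [hf _ hs, e.right_inv hy]
    simp

/-- A vector in the kernel of the derivative of a submersion is the velocity of a smooth curve
in the fibre. -/
lemma submersion_exists_curve_in_fibre [IsManifold 𝓘(ℝ, E) ∞ N] [IsManifold 𝓘(ℝ, E') ∞ X]
    {f : N → X} {x : N} (h : IsSubmersionAt 𝓘(ℝ, E) 𝓘(ℝ, E') ∞ f x)
    (ξ : TangentSpace 𝓘(ℝ, E) x) (hξ : mfderiv 𝓘(ℝ, E) 𝓘(ℝ, E') f x ξ = 0) :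
    ∃ γ : ℝ → N, γ 0 = x ∧ ContMDiffAt 𝓘(ℝ, ℝ) 𝓘(ℝ, E) ∞ γ 0 ∧
      HasMFDerivAt 𝓘(ℝ, ℝ) 𝓘(ℝ, E) γ 0 (lineMap (E := E) ξ) ∧
      ∀ᶠ t in 𝓝 (0 : ℝ), f (γ t) = f x := by
  have hfd := (h.contMDiffAt.mdifferentiableAt (by simp)).hasMFDerivAt
  obtain ⟨K, _, _, L, e, e', he, he', hx, hmaps, hf⟩ := submersion_normal_form h
  have hfx := hmaps hx
  obtain ⟨ξ', hξ'⟩ : ∃ ξ' : E, mfderiv 𝓘(ℝ, E) 𝓘(ℝ, E) e x ξ = ξ' := ⟨_, rfl⟩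
  have hline := chart_line he hx ξ ξ' hξ'
  -- In the charts `f` is the linear map `u ↦ (L u).1`, so a kernel vector has vanishing first
  -- component, and the straight line in direction `ξ'` stays in the fibre.
  have hker : (L ξ').1 = 0 := by
    have h1 := ((contMDiffAt_of_mem_maximalAtlas he' hfx).mdifferentiableAt
      (by simp)).hasMFDerivAt.comp x hfd
    have hL : HasFDerivAt (fun u : E => (L u).1)
        ((ContinuousLinearMap.fst ℝ E' K).comp (L : E →L[ℝ] E' × K)) (e x) :=
      ((ContinuousLinearMap.fst ℝ E' K).comp (L : E →L[ℝ] E' × K)).hasFDerivAt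
    have h2 := (HasMFDerivAt.comp x hL.hasMFDerivAt
      ((contMDiffAt_of_mem_maximalAtlas he hx).mdifferentiableAt
        (by simp)).hasMFDerivAt).congr_of_eventuallyEq (f₁ := e' ∘ f) (by
          filter_upwards [e.open_source.mem_nhds hx] with y hy using hf y hy)
    have h3 := congrArg (fun A : E →L[ℝ] E' => A ξ) (hasMFDerivAt_unique h1 h2)
    rw [← hξ']
    refine Eq.trans h3.symm ?_
    change mfderiv 𝓘(ℝ, E') 𝓘(ℝ, E') e' (f x) (mfderiv 𝓘(ℝ, E) 𝓘(ℝ, E') f x ξ) = 0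
    rw [hξ]
    exact map_zero _
  refine ⟨_, by simp [e.left_inv hx], hline.1, hline.2, ?_⟩
  have hc : ContinuousAt (fun t : ℝ => e x + t • ξ') 0 := by fun_prop
  have hnhds : e.target ∈ 𝓝 (e x + (0 : ℝ) • ξ') := by
    simpa using e.open_target.mem_nhds (e.map_source hx)
  filter_upwards [hc.preimage_mem_nhds hnhds] with t ht
  have hs := e.map_target ht
  refine e'.injOn (hmaps hs) hfx ?_
  rw [hf _ hs, e.right_inv ht, hf x hx]
  simp [hker]

end Manifolds

/-! ### Calculus of logarithmic derivatives. -/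

section LogDeriv

variable {E : Type*} [NormedAddCommGroup E] [NormedSpace ℝ E]
  {G : Type*} [TopologicalSpace G] [ChartedSpace E G] [Group G]
  {F : Type*} [NormedAddCommGroup F] [NormedSpace ℝ F]
  {M : Type*} [TopologicalSpace M] [ChartedSpace F M]

/-- The logarithmic derivative `s⁻¹ ds` of a map `s : M → G`. -/
def logDeriv (s : M → G) : LieForm E G F M := fun m =>
  (maurerCartan (s m)).comp (mfderiv 𝓘(ℝ, F) 𝓘(ℝ, E) s m)

variable [LieGroup 𝓘(ℝ, E) ∞ G]

lemma hasMFDerivAt_mul_left (g x : G) :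
    HasMFDerivAt 𝓘(ℝ, E) 𝓘(ℝ, E) (fun y : G => g * y) x
      (mfderiv 𝓘(ℝ, E) 𝓘(ℝ, E) (fun y : G => g * y) x) :=
  ((contMDiff_mul_left (I := 𝓘(ℝ, E)) (n := ∞) (a := g) x).mdifferentiableAt
    (by simp)).hasMFDerivAt

lemma hasMFDerivAt_mul_right (g x : G) :
    HasMFDerivAt 𝓘(ℝ, E) 𝓘(ℝ, E) (fun y : G => y * g) x
      (mfderiv 𝓘(ℝ, E) 𝓘(ℝ, E) (fun y : G => y * g) x) :=
  ((contMDiff_mul_right (I := 𝓘(ℝ, E)) (n := ∞) (a := g) x).mdifferentiableAt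
    (by simp)).hasMFDerivAt

lemma hasMFDerivAt_conj (g : G) :
    HasMFDerivAt 𝓘(ℝ, E) 𝓘(ℝ, E) (fun x : G => g * x * g⁻¹) 1 (Ad g : E →L[ℝ] E) :=
  (mdiff_conj g 1).hasMFDerivAt

lemma hasMFDerivAt_logDeriv {s : M → G} {m : M} (hs : MDifferentiableAt 𝓘(ℝ, F) 𝓘(ℝ, E) s m) :
    HasMFDerivAt 𝓘(ℝ, F) 𝓘(ℝ, E) (fun m' => (s m)⁻¹ * s m') m
      (logDeriv s m : F →L[ℝ] E) :=
  HasMFDerivAt.comp m (hasMFDerivAt_mul_left (s m)⁻¹ (s m)) hs.hasMFDerivAt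

/-- The product rule at points where both factors are `1`. -/
lemma hasMFDerivAt_mul_of_eq_one {p q : M → G} {m : M} (hp : p m = 1) (hq : q m = 1)
    {p' q' : F →L[ℝ] E}
    (hp' : HasMFDerivAt 𝓘(ℝ, F) 𝓘(ℝ, E) p m p') (hq' : HasMFDerivAt 𝓘(ℝ, F) 𝓘(ℝ, E) q m q') :
    HasMFDerivAt 𝓘(ℝ, F) 𝓘(ℝ, E) (fun m' => p m' * q m') m
      (p' + q') := by
  have hmul : MDifferentiableAt (𝓘(ℝ, E).prod 𝓘(ℝ, E)) 𝓘(ℝ, E)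
      (fun z : G × G => z.1 * z.2) (p m, q m) :=
    (contMDiff_mul 𝓘(ℝ, E) ∞ _).mdifferentiableAt (by simp)
  refine (HasMFDerivAt.comp m hmul.hasMFDerivAt (hp'.prodMk hq')).congr_mfderiv ?_
  ext v
  refine (mfderiv_prod_eq_add_apply (v := (p' v, q' v)) hmul).trans ?_
  -- The partial derivatives of multiplication are those of translations by `q m = 1` and `p m = 1`,
  -- hence identities.
  have h1 : mfderiv 𝓘(ℝ, E) 𝓘(ℝ, E) (fun z : G => z * q m) (p m) = ContinuousLinearMap.id ℝ E :=
    ((hasMFDerivAt_id (I := 𝓘(ℝ, E)) (p m)).congr_of_eventuallyEq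
      (.of_forall fun z => by simp [hq])).mfderiv
  have h2 : mfderiv 𝓘(ℝ, E) 𝓘(ℝ, E) (fun z : G => p m * z) (q m) = ContinuousLinearMap.id ℝ E :=
    ((hasMFDerivAt_id (I := 𝓘(ℝ, E)) (q m)).congr_of_eventuallyEq
      (.of_forall fun z => by simp [hp])).mfderiv
  rw [h1, h2]
  rfl

/-- Writing `(s m * k m)⁻¹ * (s * k)` as the conjugate of `(s m)⁻¹ * s` by `(k m)⁻¹`, times `(k m)⁻¹
* k`, makes both factors equal to `1` at `m`, where the product rule is a plain sum. -/
lemma logDeriv_mul {s k : M → G} {m : M} (hs : MDifferentiableAt 𝓘(ℝ, F) 𝓘(ℝ, E) s m)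
    (hk : MDifferentiableAt 𝓘(ℝ, F) 𝓘(ℝ, E) k m) :
    logDeriv (E := E) (F := F) (fun m' => s m' * k m') m =
      (Ad (k m)⁻¹).comp (logDeriv s m) + logDeriv k m := by
  have hsk : MDifferentiableAt 𝓘(ℝ, F) 𝓘(ℝ, E) (fun m' => s m' * k m') m := by
    have hmul : MDifferentiableAt (𝓘(ℝ, E).prod 𝓘(ℝ, E)) 𝓘(ℝ, E)
        (fun z : G × G => z.1 * z.2) (s m, k m) :=
      (contMDiff_mul 𝓘(ℝ, E) ∞ _).mdifferentiableAt (by simp)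
    exact (hmul.hasMFDerivAt.comp m (hs.hasMFDerivAt.prodMk hk.hasMFDerivAt)).mdifferentiableAt
  have h1 := hasMFDerivAt_comp_of_eq (f := fun m' => (s m)⁻¹ * s m')
    (inv_mul_cancel (s m)) (hasMFDerivAt_conj (E := E) (k m)⁻¹)
    (hasMFDerivAt_logDeriv hs)
  have h2 := hasMFDerivAt_mul_of_eq_one (by simp) (by simp) h1 (hasMFDerivAt_logDeriv hk)
  have h3 := hasMFDerivAt_logDeriv (E := E) hsk
  have heq : (fun m' => (s m * k m)⁻¹ * (s m' * k m')) =
      fun m' => (k m)⁻¹ * ((s m)⁻¹ * s m') * (k m)⁻¹⁻¹ * ((k m)⁻¹ * k m') := by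
    funext m'; group
  rw [← heq] at h2
  exact hasMFDerivAt_unique h3 h2

end LogDeriv

/-! ### The Lie algebra of `H` under `Ad` and logarithmic derivatives. -/

section SubgroupLieAlgebra

variable {E : Type*} [NormedAddCommGroup E] [NormedSpace ℝ E]
  {G : Type*} [TopologicalSpace G] [ChartedSpace E G] [Group G]
  {H : Subgroup G}
  {F : Type*} [NormedAddCommGroup F] [NormedSpace ℝ F]
  {M : Type*} [TopologicalSpace M] [ChartedSpace F M]

/-- The velocity of a smooth curve in `H` starting at `1` lies in the Lie algebra of `H`. -/
lemma velocity_mem_subgroupLieAlgebra {γ : ℝ → G} (h0 : γ 0 = 1)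
    (hγ : ContMDiffAt 𝓘(ℝ, ℝ) 𝓘(ℝ, E) ∞ γ 0) (hH : ∀ᶠ t in 𝓝 (0 : ℝ), γ t ∈ H)
    {ξ : GroupLieAlgebra 𝓘(ℝ, E) G}
    (hξ : HasMFDerivAt 𝓘(ℝ, ℝ) 𝓘(ℝ, E) γ 0 (lineMap (E := E) ξ)) :
    ξ ∈ subgroupLieAlgebra H := by
  refine Submodule.subset_span ⟨γ, h0, hγ, hH, ?_⟩
  rw [hξ.mfderiv]
  exact one_smul ℝ (ξ : E)

variable [LieGroup 𝓘(ℝ, E) ∞ G]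

lemma Ad_inv_apply_Ad_apply (g : G) (ξ : GroupLieAlgebra 𝓘(ℝ, E) G) : Ad g⁻¹ (Ad g ξ) = ξ := by
  rw [← ContinuousLinearMap.comp_apply, ← Ad_mul, inv_mul_cancel, Ad_one,
    ContinuousLinearMap.id_apply]

lemma Ad_apply_Ad_inv_apply (g : G) (ξ : GroupLieAlgebra 𝓘(ℝ, E) G) : Ad g (Ad g⁻¹ ξ) = ξ := by
  simpa using Ad_inv_apply_Ad_apply g⁻¹ ξ

/-- The adjoint action of `H` preserves the Lie algebra of `H`. -/
lemma Ad_mem_subgroupLieAlgebra {h : G} (hh : h ∈ H) {ξ : GroupLieAlgebra 𝓘(ℝ, E) G}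
    (hξ : ξ ∈ subgroupLieAlgebra H) : Ad h ξ ∈ subgroupLieAlgebra H := by
  induction hξ using Submodule.span_induction with
  | mem ξ hξ =>
    obtain ⟨γ, h0, hγ, hH, rfl⟩ := hξ
    have hd := hasMFDerivAt_comp_of_eq h0 (hasMFDerivAt_conj (E := E) h)
      (hγ.mdifferentiableAt (by simp)).hasMFDerivAt
    refine Submodule.subset_span ⟨fun t => h * γ t * h⁻¹, by simp [h0], ?_, ?_, ?_⟩
    · exact (contMDiffAt_const.mul hγ).mul contMDiffAt_const
    · filter_upwards [hH] with t ht
      exact H.mul_mem (H.mul_mem hh ht) (H.inv_mem hh)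
    · rw [hd.mfderiv]
      rfl
  | zero => rw [map_zero]; exact Submodule.zero_mem _
  | add x y _ _ hx hy => rw [map_add]; exact Submodule.add_mem _ hx hy
  | smul c x _ hx => rw [map_smul]; exact Submodule.smul_mem _ _ hx

/-- Both `h` and `h⁻¹` preserve `𝔥`, hence equality. With it, `IsBiInvariant.perpProj_Ad` makes `Ad`
of an element of `H` commute with the projection onto `𝔥^⊥`. -/
lemma comap_Ad_subgroupLieAlgebra {h : G} (hh : h ∈ H) :
    (subgroupLieAlgebra H).comap
      (Ad h : GroupLieAlgebra 𝓘(ℝ, E) G →L[ℝ] GroupLieAlgebra 𝓘(ℝ, E) G).toLinearMap =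
      subgroupLieAlgebra H := by
  ext ξ
  refine ⟨fun hξ => ?_, fun hξ => Ad_mem_subgroupLieAlgebra hh hξ⟩
  have := Ad_mem_subgroupLieAlgebra (H.inv_mem hh) (Submodule.mem_comap.1 hξ)
  rwa [ContinuousLinearMap.coe_coe, Ad_inv_apply_Ad_apply] at this

/-- The logarithmic derivative of a map with values in `H` takes values in the Lie algebra
of `H`. -/
lemma logDeriv_mem_subgroupLieAlgebra [IsManifold 𝓘(ℝ, F) ∞ M] {k : M → G} {m : M}
    (hk : ContMDiffAt 𝓘(ℝ, F) 𝓘(ℝ, E) ∞ k m) (hH : ∀ᶠ m' in 𝓝 m, k m' ∈ H)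
    (v : TangentSpace 𝓘(ℝ, F) m) : logDeriv (E := E) k m v ∈ subgroupLieAlgebra H := by
  -- `𝔥` is defined by curves, so `k` is tested along a curve with velocity `v` and translated to
  -- start at `1`.
  obtain ⟨c, hc0, hc, hcv⟩ := exists_curve m v
  have hd := hasMFDerivAt_comp_of_eq (f := c) hc0
    (hasMFDerivAt_logDeriv (hk.mdifferentiableAt (by simp))) hcv
  refine velocity_mem_subgroupLieAlgebra (γ := fun t => (k m)⁻¹ * k (c t)) (by simp [hc0]) ?_ ?_
    (hd.congr_mfderiv ?_)
  · exact contMDiffAt_const.mul (ContMDiffAt.comp_of_eq (g := k) (f := c) hk hc hc0)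
  · have hcc : Filter.Tendsto c (𝓝 0) (𝓝 m) := by
      have := hc.continuousAt.tendsto
      rwa [hc0] at this
    filter_upwards [hcc.eventually hH] with t ht
    exact H.mul_mem (H.inv_mem hH.self_of_nhds) ht
  · refine ContinuousLinearMap.ext_ring ?_
    exact (map_smul (logDeriv k m : F →L[ℝ] E) (1 : ℝ) (v : F))

end SubgroupLieAlgebra

/-! ### Bi-invariance and orthogonal projections. -/

section Projections

variable {E : Type*} [NormedAddCommGroup E] [NormedSpace ℝ E]
  {G : Type*} [TopologicalSpace G] [ChartedSpace E G] [Group G] [LieGroup 𝓘(ℝ, E) ∞ G]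

/-- Conjugation is a right translation followed by a left one, so each half of bi-invariance applies
to one factor. -/
lemma Ad_eq_mfderiv_comp (g : G) :
    (Ad g : E →L[ℝ] E) =
      (mfderiv 𝓘(ℝ, E) 𝓘(ℝ, E) (fun y : G => g * y) (1 * g⁻¹) : E →L[ℝ] E).comp
        (mfderiv 𝓘(ℝ, E) 𝓘(ℝ, E) (fun y : G => y * g⁻¹) 1 : E →L[ℝ] E) := by
  have h := HasMFDerivAt.comp (1 : G) (hasMFDerivAt_mul_left (E := E) g (1 * g⁻¹))
    (hasMFDerivAt_mul_right g⁻¹ 1)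
  exact hasMFDerivAt_unique (hasMFDerivAt_conj g)
    (h.congr_of_eventuallyEq (.of_forall fun y => mul_assoc g y g⁻¹))

/-- A bi-invariant metric induces an `Ad`-invariant scalar product. -/
lemma IsBiInvariant.lieInner_Ad {B : Metric E G} (hB : IsBiInvariant B) (g : G)
    (ξ η : GroupLieAlgebra 𝓘(ℝ, E) G) : lieInner B (Ad g ξ) (Ad g η) = lieInner B ξ η := by
  -- The two translations end at `g * (1 * g⁻¹)`, which is `1` only up to a proved equation; the
  -- scalar product is transported along it.
  have key : ∀ p : G, p = 1 → ∀ u v : E, lieInner B u v = B.inner p u v := by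
    rintro p rfl u v; rfl
  refine (key (g * (1 * g⁻¹)) (by simp) _ _).trans ?_
  have h1 := hB.right g⁻¹ 1 ξ η
  rw [← hB.left g (1 * g⁻¹)] at h1
  have h2 : ∀ ζ : E, (Ad g : E →L[ℝ] E) ζ = _ := fun ζ =>
    congrArg (fun L : E →L[ℝ] E => L ζ) (Ad_eq_mfderiv_comp g)
  refine Eq.trans ?_ h1
  exact congrArg₂ (fun u v : E => B.inner (g * (1 * g⁻¹)) u v) (h2 ξ) (h2 η)

variable [FiniteDimensional ℝ E]

lemma perpProj_mem (B : Metric E G) (V : Submodule ℝ (GroupLieAlgebra 𝓘(ℝ, E) G))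
    (ξ : GroupLieAlgebra 𝓘(ℝ, E) G) : perpProj B V ξ ∈ (lieInner B).orthogonal V :=
  Submodule.projection_apply_mem (isCompl_orthogonal B V) ξ

lemma sub_perpProj_mem (B : Metric E G) (V : Submodule ℝ (GroupLieAlgebra 𝓘(ℝ, E) G))
    (ξ : GroupLieAlgebra 𝓘(ℝ, E) G) : ξ - perpProj B V ξ ∈ V :=
  Submodule.sub_projection_mem (isCompl_orthogonal B V) ξ

lemma perpProj_eq_zero (B : Metric E G) {V : Submodule ℝ (GroupLieAlgebra 𝓘(ℝ, E) G)}
    {ξ : GroupLieAlgebra 𝓘(ℝ, E) G} (hξ : ξ ∈ V) : perpProj B V ξ = 0 :=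
  (Submodule.projection_apply_eq_zero_iff (isCompl_orthogonal B V)).2 hξ

lemma perpProj_eq_self (B : Metric E G) {V : Submodule ℝ (GroupLieAlgebra 𝓘(ℝ, E) G)}
    {ξ : GroupLieAlgebra 𝓘(ℝ, E) G} (hξ : ξ ∈ (lieInner B).orthogonal V) :
    perpProj B V ξ = ξ :=
  Submodule.projection_apply_of_mem_left (isCompl_orthogonal B V) hξ

/-- The adjoint action intertwines the projections onto `V^⊥` and `(Ad(g) V)^⊥`. -/
lemma IsBiInvariant.perpProj_Ad {B : Metric E G} (hB : IsBiInvariant B) (g : G)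
    (V : Submodule ℝ (GroupLieAlgebra 𝓘(ℝ, E) G)) (ξ : GroupLieAlgebra 𝓘(ℝ, E) G) :
    perpProj B (V.comap (Ad g⁻¹ : GroupLieAlgebra 𝓘(ℝ, E) G →L[ℝ] _).toLinearMap) (Ad g ξ) =
      Ad g (perpProj B V ξ) := by
  set W := V.comap (Ad g⁻¹ : GroupLieAlgebra 𝓘(ℝ, E) G →L[ℝ] _).toLinearMap with hW
  -- `W` is `Ad(g)V`. The isometry `Ad g` carries the splitting of `ξ` along `V^⊥` and `V` to one
  -- along `W^⊥` and `W`, which is unique.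
  have h1 : Ad g (perpProj B V ξ) ∈ (lieInner B).orthogonal W := by
    intro η hη
    have h := perpProj_mem B V ξ (Ad g⁻¹ η) hη
    have h' := hB.lieInner_Ad g (Ad g⁻¹ η) (perpProj B V ξ)
    rw [Ad_apply_Ad_inv_apply] at h'
    exact h'.trans h
  have h2 : Ad g ξ - Ad g (perpProj B V ξ) ∈ W := by
    rw [← map_sub]
    change Ad g⁻¹ (Ad g (ξ - perpProj B V ξ)) ∈ V
    rw [Ad_inv_apply_Ad_apply]
    exact sub_perpProj_mem B V ξ
  have h3 := perpProj_eq_zero B h2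
  rw [map_sub, perpProj_eq_self B h1] at h3
  exact sub_eq_zero.1 h3

end Projections

/-! ### The gauge action on potentials. -/

section GaugeAction

variable {E : Type*} [NormedAddCommGroup E] [NormedSpace ℝ E]
  {G : Type*} [TopologicalSpace G] [ChartedSpace E G] [Group G] [LieGroup 𝓘(ℝ, E) ∞ G]
  {F : Type*} [NormedAddCommGroup F] [NormedSpace ℝ F]
  {M : Type*} [TopologicalSpace M] [ChartedSpace F M]

/-- The explicit formula `a^w = Ad(w⁻¹) a + w⁻¹dw`. -/
lemma gaugeAction_apply {w : M → G} {m : M} (hw : MDifferentiableAt 𝓘(ℝ, F) 𝓘(ℝ, E) w m)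
    (a : LieForm E G F M) (v : TangentSpace 𝓘(ℝ, F) m) :
    gaugeAction w a m v = Ad (w m)⁻¹ (a m v) + logDeriv w m v := by
  have key : ∀ p : M × G, p = (m, w m) → ∀ Z : F × E, connectionOfPotential a p Z =
      Ad (w m)⁻¹ (a m Z.1) + maurerCartan (w m) (Z.2 : TangentSpace 𝓘(ℝ, E) (w m)) := by
    rintro _ rfl Z
    unfold connectionOfPotential
    rw [mfderiv_fst, mfderiv_snd]
    rfl
  have hs : MDifferentiableAt 𝓘(ℝ, F) (𝓘(ℝ, F).prod 𝓘(ℝ, E)) (fun m' : M => (m', (1 : G))) m :=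
    mdifferentiableAt_id.prodMk mdifferentiableAt_const
  have hg : MDifferentiableAt (𝓘(ℝ, F).prod 𝓘(ℝ, E)) (𝓘(ℝ, F).prod 𝓘(ℝ, E)) (gaugeMap w)
      (m, (1 : G)) := by
    have hw' : MDifferentiableAt (𝓘(ℝ, F).prod 𝓘(ℝ, E)) 𝓘(ℝ, E) (fun p : M × G => w p.1)
        (m, (1 : G)) := MDifferentiableAt.comp (g := w) (m, (1 : G)) hw mdifferentiableAt_fst
    have hmul : MDifferentiableAt (𝓘(ℝ, E).prod 𝓘(ℝ, E)) 𝓘(ℝ, E)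
        (fun z : G × G => z.1 * z.2) (w m, 1) :=
      (contMDiff_mul 𝓘(ℝ, E) ∞ _).mdifferentiableAt (by simp)
    exact mdifferentiableAt_fst.prodMk (MDifferentiableAt.comp (g := fun z : G × G => z.1 * z.2)
      (f := fun p : M × G => (w p.1, p.2)) (m, (1 : G)) hmul (hw'.prodMk mdifferentiableAt_snd))
  -- `f_w` composed with the unit section is the graph `m ↦ (m, w m)`, whose derivative is `v ↦ (v,
  -- dw v)`.
  have h1 := HasMFDerivAt.comp m hg.hasMFDerivAt hs.hasMFDerivAt
  have h2 := ((hasMFDerivAt_id (I := 𝓘(ℝ, F)) m).prodMk hw.hasMFDerivAt).congr_of_eventuallyEq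
    (f₁ := gaugeMap w ∘ fun m' : M => (m', (1 : G))) (.of_forall fun m' => by simp [gaugeMap])
  have h3 := congrArg (fun L : F →L[ℝ] F × E => L v) (hasMFDerivAt_unique h1 h2)
  refine (key (gaugeMap w (m, 1)) (by simp [gaugeMap]) _).trans ?_
  exact congrArg (fun Z : F × E => Ad (w m)⁻¹ (a m Z.1) +
    maurerCartan (w m) (Z.2 : TangentSpace 𝓘(ℝ, E) (w m))) h3

end GaugeAction

/-! ### The coisotropy form and gauge covariance. -/

section Coset

variable {E : Type*} [NormedAddCommGroup E] [NormedSpace ℝ E]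
  {G : Type*} [TopologicalSpace G] [ChartedSpace E G] [Group G] [LieGroup 𝓘(ℝ, E) ∞ G]
  {H : Subgroup G}
  {E' : Type*} [NormedAddCommGroup E'] [NormedSpace ℝ E'] [ChartedSpace E' (G ⧸ H)]
  {F : Type*} [NormedAddCommGroup F] [NormedSpace ℝ F]
  {M : Type*} [TopologicalSpace M] [ChartedSpace F M]

/-- `ξ ↦ g (π_* ξ)` is the composite of the differentials of `γ ↦ g γ` and of `π`. -/
lemma hasMFDerivAt_coset (hX : Manifold.IsSubmersion 𝓘(ℝ, E) 𝓘(ℝ, E') ∞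
    (QuotientGroup.mk : G → G ⧸ H)) (x : G ⧸ H) :
    HasMFDerivAt 𝓘(ℝ, E) 𝓘(ℝ, E') (fun γ : G => ((Quotient.out x * γ : G) : G ⧸ H)) 1
      (liftMap (E := E) (E' := E') x : E →L[ℝ] E') := by
  have h1 : MDifferentiableAt 𝓘(ℝ, E) 𝓘(ℝ, E') (QuotientGroup.mk : G → G ⧸ H)
      (Quotient.out x * 1) := ((hX.isSubmersionAt _).contMDiffAt).mdifferentiableAt (by simp)
  exact (h1.hasMFDerivAt.comp (1 : G)
    (hasMFDerivAt_mul_left (Quotient.out x) 1)).mdifferentiableAt.hasMFDerivAt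

/-- If `s` is a local lift of `φ` through the representative of `φ m`, then
`dφ = g (π_* (s⁻¹ ds))`. -/
lemma liftMap_logDeriv (hX : Manifold.IsSubmersion 𝓘(ℝ, E) 𝓘(ℝ, E') ∞
    (QuotientGroup.mk : G → G ⧸ H)) {φ : M → G ⧸ H} {s : M → G} {m : M}
    (hs : MDifferentiableAt 𝓘(ℝ, F) 𝓘(ℝ, E) s m) (hsm : s m = Quotient.out (φ m))
    (hsφ : ∀ᶠ m' in 𝓝 m, (s m' : G ⧸ H) = φ m') (v : TangentSpace 𝓘(ℝ, F) m) :
    liftMap (φ m) (logDeriv (E := E) s m v) = mfderiv 𝓘(ℝ, F) 𝓘(ℝ, E') φ m v := by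
  have h1 := hasMFDerivAt_comp_of_eq (f := fun m' => (s m)⁻¹ * s m') (inv_mul_cancel (s m))
    (hasMFDerivAt_coset hX (φ m)) (hasMFDerivAt_logDeriv hs)
  have h2 := h1.congr_of_eventuallyEq (f₁ := φ) (by
    filter_upwards [hsφ] with m' hm'
    rw [← hsm, mul_inv_cancel_left, hm'])
  have h3 := h2.mfderiv
  exact (congrArg (fun L : F →L[ℝ] E' => L v) h3).symm

/-- The kernel of `ξ ↦ g (π_* ξ)` is contained in the Lie algebra of `H`. -/
lemma mem_subgroupLieAlgebra_of_liftMap_eq_zero [IsManifold 𝓘(ℝ, E') ∞ (G ⧸ H)]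
    (hX : Manifold.IsSubmersion 𝓘(ℝ, E) 𝓘(ℝ, E') ∞ (QuotientGroup.mk : G → G ⧸ H))
    (x : G ⧸ H) {ξ : GroupLieAlgebra 𝓘(ℝ, E) G} (hξ : liftMap (E' := E') x ξ = 0) :
    ξ ∈ subgroupLieAlgebra H := by
  obtain ⟨g, hg⟩ : ∃ g : G, g = Quotient.out x := ⟨_, rfl⟩
  have hsub := hX.isSubmersionAt (g * 1)
  have hleft := hasMFDerivAt_mul_left (E := E) g 1
  obtain ⟨η, hη⟩ : ∃ η : E, mfderiv 𝓘(ℝ, E) 𝓘(ℝ, E) (fun y : G => g * y) 1 ξ = η := ⟨_, rfl⟩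
  have h1 := HasMFDerivAt.comp (1 : G) (hsub.contMDiffAt.mdifferentiableAt (by simp)).hasMFDerivAt
    hleft
  -- The left translate `η` of `ξ` is killed by `dπ`, hence is the velocity of a curve in `gH`;
  -- translating back by `g⁻¹` gives a curve in `H` with velocity `ξ`.
  have hker : mfderiv 𝓘(ℝ, E) 𝓘(ℝ, E') (QuotientGroup.mk : G → G ⧸ H) (g * 1) η = 0 := by
    rw [← hη]
    refine Eq.trans ?_ hξ
    unfold liftMap
    rw [← hg]
    exact (congrArg (fun L : E →L[ℝ] E' => L ξ) h1.mfderiv).symm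
  obtain ⟨γ, h0, hγ, hγd, hfib⟩ := submersion_exists_curve_in_fibre hsub η hker
  have h0' : γ 0 = g := by rw [h0, mul_one]
  have hinv : HasMFDerivAt 𝓘(ℝ, E) 𝓘(ℝ, E) (fun y : G => g⁻¹ * y) (g * 1) _ :=
    hasMFDerivAt_mul_left g⁻¹ (g * 1)
  have hd := hasMFDerivAt_comp_of_eq h0 hinv hγd
  refine velocity_mem_subgroupLieAlgebra (γ := fun t => g⁻¹ * γ t) (by simp [h0]) ?_ ?_
    (hd.congr_mfderiv ?_)
  · exact contMDiffAt_const.mul hγ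
  · filter_upwards [hfib] with t ht
    rw [mul_one] at ht
    exact QuotientGroup.eq.1 ht.symm
  · have h2 := HasMFDerivAt.comp (1 : G) hinv hleft
    have h3 := (hasMFDerivAt_id (I := 𝓘(ℝ, E)) (1 : G)).congr_of_eventuallyEq
      (f₁ := (fun y : G => g⁻¹ * y) ∘ fun y : G => g * y) (.of_forall fun y => by simp)
    have h4 := congrArg (fun L : E →L[ℝ] E => L ξ) (hasMFDerivAt_unique h2 h3)
    refine ContinuousLinearMap.ext_ring ?_
    rw [← hη]
    exact (congrArg (mfderiv 𝓘(ℝ, E) 𝓘(ℝ, E) (fun y : G => g⁻¹ * y) (g * 1))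
      (one_smul ℝ (mfderiv 𝓘(ℝ, E) 𝓘(ℝ, E) (fun y : G => g * y) 1 ξ : E))).trans
      (h4.trans (one_smul ℝ (ξ : E)).symm)

/-- The map `ξ ↦ g (π_* ξ)` has a linear right inverse. -/
lemma exists_liftMap_rightInverse [FiniteDimensional ℝ E'] [IsManifold 𝓘(ℝ, E') ∞ (G ⧸ H)]
    (hX : Manifold.IsSubmersion 𝓘(ℝ, E) 𝓘(ℝ, E') ∞ (QuotientGroup.mk : G → G ⧸ H))
    (x : G ⧸ H) :
    ∃ s : TangentSpace 𝓘(ℝ, E') x →L[ℝ] GroupLieAlgebra 𝓘(ℝ, E) G, ∀ S, liftMap x (s S) = S := by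
  obtain ⟨σ, hσ0, hσ, hσmk⟩ := submersion_exists_section (hX.isSubmersionAt (Quotient.out x))
  rw [QuotientGroup.out_eq'] at hσ0 hσ hσmk
  -- A local section of `π` is a local lift of the identity of `G/H`.
  refine ⟨logDeriv σ x, fun S => ?_⟩
  have h := liftMap_logDeriv hX (φ := id) (hσ.mdifferentiableAt (by simp)) hσ0 hσmk S
  rw [mfderiv_id] at h
  exact h

variable [FiniteDimensional ℝ E]

/-- The defining property `ω^⊥(g (π_* ξ)) = Ad(g) pr_{𝔥^⊥} ξ` of the coisotropy form. -/
lemma coisotropyForm_liftMap [FiniteDimensional ℝ E'] [IsManifold 𝓘(ℝ, E') ∞ (G ⧸ H)]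
    (hX : Manifold.IsSubmersion 𝓘(ℝ, E) 𝓘(ℝ, E') ∞ (QuotientGroup.mk : G → G ⧸ H))
    (B : Metric E G) (x : G ⧸ H) (ξ : GroupLieAlgebra 𝓘(ℝ, E) G) :
    coisotropyForm (E' := E') B x (liftMap x ξ) =
      Ad (Quotient.out x) (perpProj B (subgroupLieAlgebra H) ξ) := by
  -- Existence of a right inverse makes the `Classical.epsilon` choice one; two preimages of a
  -- vector differ by an element of `𝔥`, which the projection kills.
  have hs := Classical.epsilon_spec (exists_liftMap_rightInverse (E' := E') hX x)
  unfold coisotropyForm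
  generalize Classical.epsilon (fun s : TangentSpace 𝓘(ℝ, E') x →L[ℝ] GroupLieAlgebra 𝓘(ℝ, E) G =>
    ∀ S, liftMap x (s S) = S) = s at hs ⊢
  have h1 : liftMap (E' := E') x (s (liftMap x ξ) - ξ) = 0 := by
    rw [map_sub, hs, sub_self]
  have h2 := perpProj_eq_zero B (mem_subgroupLieAlgebra_of_liftMap_eq_zero hX x h1)
  rw [map_sub, sub_eq_zero] at h2
  simp only [ContinuousLinearMap.comp_apply, h2]

/-- The gauge covariance `D_φ (a^w) = Ad(w⁻¹) D_φ a` for `w` stabilizing `φ`. -/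
lemma D_gaugeAction_apply [FiniteDimensional ℝ E'] [IsManifold 𝓘(ℝ, E') ∞ (G ⧸ H)]
    [IsManifold 𝓘(ℝ, F) ∞ M] {B : Metric E G} (hB : IsBiInvariant B)
    (hX : Manifold.IsSubmersion 𝓘(ℝ, E) 𝓘(ℝ, E') ∞ (QuotientGroup.mk : G → G ⧸ H))
    {φ : M → G ⧸ H} (hφ : ContMDiff 𝓘(ℝ, F) 𝓘(ℝ, E') ∞ φ)
    {w : M → G} (hw : ContMDiff 𝓘(ℝ, F) 𝓘(ℝ, E) ∞ w) (hwφ : ∀ m, w m • φ m = φ m)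
    (a : LieForm E G F M) (m : M) (v : TangentSpace 𝓘(ℝ, F) m) :
    D E' B φ (gaugeAction w a) m v = Ad (w m)⁻¹ (D E' B φ a m v) := by
  -- a local lift `s` of `φ` and the `H`-valued map `k = s⁻¹ w s`
  obtain ⟨σ, hσ0, hσ, hσmk⟩ :=
    submersion_exists_section (hX.isSubmersionAt (Quotient.out (φ m)))
  rw [QuotientGroup.out_eq'] at hσ0 hσ hσmk
  obtain ⟨s, hs⟩ : ∃ s : M → G, s = fun m' => σ (φ m') := ⟨_, rfl⟩
  -- The lift must pass through this representative, as `liftMap` and `coisotropyForm` are built on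
  -- it.
  have hsm : s m = Quotient.out (φ m) := by rw [hs]; exact hσ0
  have hsd : ContMDiffAt 𝓘(ℝ, F) 𝓘(ℝ, E) ∞ s m := by
    rw [hs]; exact ContMDiffAt.comp m hσ (hφ m)
  have hsφ : ∀ᶠ m' in 𝓝 m, (s m' : G ⧸ H) = φ m' := by
    rw [hs]; exact hφ.continuous.continuousAt.eventually hσmk
  obtain ⟨k, hk⟩ : ∃ k : M → G, k = fun m' => (s m')⁻¹ * w m' * s m' := ⟨_, rfl⟩
  have hkd : ContMDiffAt 𝓘(ℝ, F) 𝓘(ℝ, E) ∞ k m := by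
    rw [hk]; exact (hsd.inv.mul (hw m)).mul hsd
  have hkH : ∀ᶠ m' in 𝓝 m, k m' ∈ H := by
    filter_upwards [hsφ] with m' hm'
    have h := hwφ m'
    rw [← hm', MulAction.Quotient.smul_coe] at h
    have h' := QuotientGroup.eq.1 h.symm
    rw [hk]
    simpa [mul_assoc] using h'
  have hws : (fun m' => w m' * s m') = fun m' => s m' * k m' := by
    funext m'; rw [hk]; group
  have hkm : k m ∈ H := hkH.self_of_nhds
  -- the derivative of `w s = s k`
  have hdiff := congrArg (fun L : TangentSpace 𝓘(ℝ, F) m →L[ℝ] GroupLieAlgebra 𝓘(ℝ, E) G => L v)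
    ((logDeriv_mul ((hw m).mdifferentiableAt (by simp)) (hsd.mdifferentiableAt (by simp))).symm.trans
      ((congrFun (congrArg (logDeriv (E := E) (F := F)) hws) m).trans
        (logDeriv_mul (hsd.mdifferentiableAt (by simp)) (hkd.mdifferentiableAt (by simp)))))
  obtain ⟨τ, hτ⟩ : ∃ τ, τ = logDeriv (E := E) w m v := ⟨_, rfl⟩
  obtain ⟨ζ, hζ⟩ : ∃ ζ, ζ = logDeriv (E := E) s m v := ⟨_, rfl⟩
  have hκ : logDeriv (E := E) k m v ∈ subgroupLieAlgebra H :=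
    logDeriv_mem_subgroupLieAlgebra hkd hkH v
  have hdiff' : Ad (s m)⁻¹ τ = Ad (k m)⁻¹ ζ + logDeriv (E := E) k m v - ζ := by
    rw [hτ, hζ]
    exact eq_sub_of_add_eq hdiff
  -- equivariance of the projections
  have hPs : ∀ ξ : GroupLieAlgebra 𝓘(ℝ, E) G, perpProj B (isotropyAlgebra (φ m)) ξ =
      Ad (s m) (perpProj B (subgroupLieAlgebra H) (Ad (s m)⁻¹ ξ)) := by
    intro ξ
    have h := hB.perpProj_Ad (s m) (subgroupLieAlgebra H) (Ad (s m)⁻¹ ξ)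
    rw [Ad_apply_Ad_inv_apply] at h
    rw [← h, isotropyAlgebra, hsm]
  have hPk : ∀ ξ : GroupLieAlgebra 𝓘(ℝ, E) G, perpProj B (subgroupLieAlgebra H) (Ad (k m)⁻¹ ξ) =
      Ad (k m)⁻¹ (perpProj B (subgroupLieAlgebra H) ξ) := by
    intro ξ
    have h := hB.perpProj_Ad (k m)⁻¹ (subgroupLieAlgebra H) ξ
    rwa [inv_inv, comap_Ad_subgroupLieAlgebra hkm] at h
  have hAd : ∀ ξ : GroupLieAlgebra 𝓘(ℝ, E) G,
      Ad (s m)⁻¹ (Ad (w m)⁻¹ ξ) = Ad (k m)⁻¹ (Ad (s m)⁻¹ ξ) := by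
    intro ξ
    rw [← ContinuousLinearMap.comp_apply, ← ContinuousLinearMap.comp_apply, ← Ad_mul, ← Ad_mul,
      ← mul_inv_rev, ← mul_inv_rev, congrFun hws m]
  have hAd' : ∀ ξ : GroupLieAlgebra 𝓘(ℝ, E) G,
      Ad (w m)⁻¹ (Ad (s m) ξ) = Ad (s m) (Ad (k m)⁻¹ ξ) := by
    intro ξ
    have h := congrArg (Ad (s m)) (hAd (Ad (s m) ξ))
    rwa [Ad_apply_Ad_inv_apply, Ad_inv_apply_Ad_apply] at h
  have hc : pullbackCoisotropy E' B φ m v =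
      Ad (s m) (perpProj B (subgroupLieAlgebra H) ζ) := by
    have h := coisotropyForm_liftMap hX B (φ m) ζ
    rw [hζ, liftMap_logDeriv hX (hsd.mdifferentiableAt (by simp)) hsm hsφ, ← hsm, ← hζ] at h
    exact h
  change perpProj B (isotropyAlgebra (φ m)) (gaugeAction w a m v) + pullbackCoisotropy E' B φ m v =
    Ad (w m)⁻¹ (perpProj B (isotropyAlgebra (φ m)) (a m v) + pullbackCoisotropy E' B φ m v)
  -- The `-ζ` in `hdiff'` cancels the pullback term on the left, and the `Ad (k m)⁻¹ ζ` term becomes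
  -- its `Ad (w m)⁻¹`-image on the right.
  rw [gaugeAction_apply ((hw m).mdifferentiableAt (by simp)), ← hτ, hc, hPs, hPs, map_add, hAd,
    hdiff', map_add, map_add, map_sub, map_add, hPk, hPk, perpProj_eq_zero B hκ, map_add (Ad (w m)⁻¹),
    hAd', hAd']
  simp only [map_sub, add_zero]
  abel

end Coset

end CosetGauge

end

theorem corollaryC
    -- a Lie group `G` with a bi-invariant Riemannian metric
    {E : Type*} [NormedAddCommGroup E] [NormedSpace ℝ E] [FiniteDimensional ℝ E]
    {G : Type*} [TopologicalSpace G] [ChartedSpace E G] [Group G] [LieGroup 𝓘(ℝ, E) ∞ G]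
    (B : CosetGauge.Metric E G) (hB : CosetGauge.IsBiInvariant B)
    -- a closed subgroup `H`, and `X = G/H` with its quotient manifold structure, i.e. the one for
    -- which the quotient map is a smooth submersion
    (H : Subgroup G) (hH : IsClosed (H : Set G))
    {E' : Type*} [NormedAddCommGroup E'] [NormedSpace ℝ E'] [FiniteDimensional ℝ E']
    [ChartedSpace E' (G ⧸ H)] [IsManifold 𝓘(ℝ, E') ∞ (G ⧸ H)]
    (hX : Manifold.IsSubmersion 𝓘(ℝ, E) 𝓘(ℝ, E') ∞ (QuotientGroup.mk : G → G ⧸ H))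
    -- a smooth manifold `M` and a smooth map `φ : M → G/H`
    {F : Type*} [NormedAddCommGroup F] [NormedSpace ℝ F] [FiniteDimensional ℝ F]
    {M : Type*} [TopologicalSpace M] [ChartedSpace F M] [IsManifold 𝓘(ℝ, F) ∞ M]
    (φ : M → G ⧸ H) (hφ : ContMDiff 𝓘(ℝ, F) 𝓘(ℝ, E') ∞ φ)
    -- a smooth map `w : M → G` stabilizing `φ`
    (w : M → G) (hw : ContMDiff 𝓘(ℝ, F) 𝓘(ℝ, E) ∞ w) (hwφ : ∀ m, w m • φ m = φ m)
    -- a gauge potential on `M × G`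
    (a : CosetGauge.LieForm E G F M) :
    CosetGauge.D E' B φ (CosetGauge.gaugeAction w a) =
      fun m => (CosetGauge.Ad (w m)⁻¹).comp (CosetGauge.D E' B φ a m) := by
  funext m
  ext v
  exact CosetGauge.D_gaugeAction_apply hB hX hφ hw hwφ a m v
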